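/- Let $H$ be a complex Hilbert space, let $A$ be a closed (possibly unbounded) linear operator in $H$ with domain $D(A)\subseteq H$, and let $B\in B(H)$ be a bounded linear operator defined on all of $H$. Products and sums of operators carry their natural domains: $D(ST)=\{x\in D(T): Tx\in D(S)\}$ and $D(S+T)=D(S)\cap D(T)$. An operator $T$ is called positive if $\langle Tx,x\rangle\ge 0$ for all $x\in D(T)$, and invertible if it has an everywhere defined bounded inverse, i.e. if there is $T^{-1}\in B(H)$ with $T^{-1}T\subseteq I$ and $TT^{-1}=I$. For a closed densely defined operator $T$, $|T|=\sqrt{T^*T}$ denotes the unique positive self-adjoint operator with $|T|^2=T^*T$. 1. If $BA$ is positive and invertible, then $A$ is densely defined (so that $|A|$ makes sense), $|A|^2+|B^*|^2$ is invertible, and $$\langle(|A|^2+|B^*|^2)^{-1}x,x\rangle\le\langle(BA)^{-1}x,x\rangle\qquad\text{for all }x\in H.$$ 2. If $A$ is densely defined and $AB$ is densely defined, positive and invertible, then $|A^*|^2+|B|^2$ is invertible, and $$\langle(|A^*|^2+|B|^2)^{-1}x,x\rangle\le\langle(AB)^{-1}x,x\rangle\qquad\text{for all }x\in H.$$ -/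

import Mathlib

open scoped InnerProductSpace ComplexOrder

namespace UnbOp

variable {H : Type*} [NormedAddCommGroup H] [InnerProductSpace ℂ H]

/-- A bounded operator on `H`, seen as an operator with domain all of `H`. -/
def ofBdd (B : H →L[ℂ] H) : H →ₗ.[ℂ] H :=
  (B : H →ₗ[ℂ] H).toPMap ⊤

/-- The product `S T` of two (possibly unbounded) operators, with its natural domain
`D(S T) = {x ∈ D(T) : T x ∈ D(S)}`. -/
def prod (S T : H →ₗ.[ℂ] H) : H →ₗ.[ℂ] H where
  domain :=
    { carrier := {x | ∃ hx : x ∈ T.domain, T ⟨x, hx⟩ ∈ S.domain}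
      zero_mem' := ⟨T.domain.zero_mem, by
        have h : T ⟨0, T.domain.zero_mem⟩ = 0 := T.map_zero
        rw [h]; exact S.domain.zero_mem⟩
      add_mem' := by
        rintro x y ⟨hx, hx'⟩ ⟨hy, hy'⟩
        refine ⟨T.domain.add_mem hx hy, ?_⟩
        have h : T ⟨x + y, T.domain.add_mem hx hy⟩ = T ⟨x, hx⟩ + T ⟨y, hy⟩ :=
          T.map_add ⟨x, hx⟩ ⟨y, hy⟩
        rw [h]; exact S.domain.add_mem hx' hy'
      smul_mem' := by
        rintro c x ⟨hx, hx'⟩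
        refine ⟨T.domain.smul_mem c hx, ?_⟩
        have h : T ⟨c • x, T.domain.smul_mem c hx⟩ = c • T ⟨x, hx⟩ :=
          T.map_smul c ⟨x, hx⟩
        rw [h]; exact S.domain.smul_mem c hx' }
  toFun :=
    { toFun := fun x => S ⟨T ⟨x, x.2.1⟩, x.2.2⟩
      map_add' := fun x y => by
        rw [← S.map_add]
        congr 1
        exact Subtype.ext (T.map_add ⟨x, x.2.1⟩ ⟨y, y.2.1⟩)
      map_smul' := fun c x => by
        rw [RingHom.id_apply, ← S.map_smul]
        congr 1
        exact Subtype.ext (T.map_smul c ⟨x, x.2.1⟩) }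

/-- `T` is positive: `⟨T x, x⟩` is real and nonnegative for every `x` in the domain of `T`. -/
def IsPositive (T : H →ₗ.[ℂ] H) : Prop :=
  ∀ x : T.domain, 0 ≤ ⟪T x, (x : H)⟫_ℂ

/-- The bounded everywhere defined operator `C` is the inverse of `T`:
`C T ⊆ I` and `T C = I`. -/
def IsInverse (T : H →ₗ.[ℂ] H) (C : H →L[ℂ] H) : Prop :=
  (∀ x : T.domain, C (T x) = x) ∧ ∀ y : H, ∃ h : C y ∈ T.domain, T ⟨C y, h⟩ = y

/-- `T` is invertible: it has a bounded inverse defined on all of `H`. -/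
def IsInvertible (T : H →ₗ.[ℂ] H) : Prop :=
  ∃ C : H →L[ℂ] H, IsInverse T C

open scoped Classical in
/-- The inverse `T⁻¹` of an invertible operator (and `0` if `T` is not invertible). -/
noncomputable def inv (T : H →ₗ.[ℂ] H) : H →L[ℂ] H :=
  if h : IsInvertible T then h.choose else 0

theorem inv_spec {T : H →ₗ.[ℂ] H} (h : IsInvertible T) : IsInverse T (inv T) := by
  unfold inv
  rw [dif_pos h]
  exact h.choose_spec

variable [CompleteSpace H]

/-- `P` is an absolute value of `T`: a positive self-adjoint operator with `P P = T* T`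
(with equality of domains). For `T` closed and densely defined there is exactly one. -/
def IsAbs (T P : H →ₗ.[ℂ] H) : Prop :=
  IsSelfAdjoint P ∧ IsPositive P ∧ prod P P = prod T.adjoint T

open scoped Classical in
/-- The absolute value `|T| = √(T* T)` of a closed densely defined operator `T`
(and `0` if there is none). -/
noncomputable def abs (T : H →ₗ.[ℂ] H) : H →ₗ.[ℂ] H :=
  if h : ∃ P, IsAbs T P then h.choose else 0

end UnbOp

/-!
Both parts are instances of one estimate, `UnbOp.isInvertible_and_inner_inv_le`: if `A` is closed
and densely defined, `D` is bounded, and a bounded operator `C ≥ 0` satisfies `C D* A ⊆ I`, then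
`S = A* A + D* D` is invertible and `S⁻¹ ≤ C`. The first part is the case `D = B*`,
`C = (B A)⁻¹`; the second is the case of `A*` in place of `A`, with `D = B` and `C = (A B)⁻¹`, since
`B* A* ⊆ (A B)* = A B`.

For the estimate, `x = C D* A x` shows that `A` is bounded below. The form of `S` is
`‖A x‖² + ‖D x‖²`, so `S` is coercive, and `S x = y` is solved weakly by inverting a coercive bounded
operator on the graph of `A` (`UnbOp.exists_weak_solution`). If `S x = y` and `w = D* A x`, then
`C w = x`, and expanding `0 ≤ ⟪C (w - y), w - y⟫` gives
`2 ⟪S x, x⟫ ≤ Re ⟪D x, A x⟫ + ⟪C y, y⟫ ≤ ⟪S x, x⟫ + ⟪C y, y⟫`, that is `⟪y, S⁻¹ y⟫ ≤ ⟪C y, y⟫`.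

What remains is that `|A|² = A* A` holds for the chosen absolute value, i.e. that an absolute value
exists (`UnbOp.exists_isAbs`). No unbounded spectral theorem is needed: `R = (A* A + 1)⁻¹` is bounded
with `0 ≤ R ≤ 1`, and `√(1 - R) (√R)⁻¹` is self-adjoint, positive, and has square `A* A`. In the
second part this is applied to `A*`, whose domain is dense by `UnbOp.dense_adjoint_domain`.
-/

namespace UnbOp

section

variable {H : Type*} [NormedAddCommGroup H] [InnerProductSpace ℂ H]

/-! ### Bounded inverses and positivity -/

/-- A surjective operator that is bounded below is invertible. -/
theorem isInvertible_of_surjective {T : H →ₗ.[ℂ] H} (c : ℝ)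
    (hc : ∀ x : T.domain, ‖(x : H)‖ ≤ c * ‖T x‖) (hs : ∀ y, ∃ x : T.domain, T x = y) :
    IsInvertible T := by
  have hinj : Function.Injective T.toFun := by
    refine (injective_iff_map_eq_zero _).2 fun x hx => ?_
    have h := hc x
    rw [show T x = 0 from hx, norm_zero, mul_zero] at h
    exact Subtype.ext (norm_le_zero_iff.1 h)
  let e := LinearEquiv.ofBijective T.toFun ⟨hinj, hs⟩
  have he : ∀ y, T (e.symm y) = y := fun y => e.apply_symm_apply y
  refine ⟨(T.domain.subtype ∘ₗ e.symm.toLinearMap).mkContinuous c fun y => ?_,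
    fun x => ?_, fun y => ⟨(e.symm y).2, he y⟩⟩
  · have h := hc (e.symm y)
    rwa [he] at h
  · exact congrArg Subtype.val (e.symm_apply_apply x)

theorem injective_of_isInverse {T : H →ₗ.[ℂ] H} {C : H →L[ℂ] H} (h : IsInverse T C) :
    Function.Injective C := by
  refine (injective_iff_map_eq_zero C).2 fun y hy => ?_
  obtain ⟨h1, h2⟩ := h.2 y
  rw [← h2, ← T.map_zero]
  exact congrArg T (Subtype.ext hy)

theorem nonneg_of_inner_nonneg {C : H →L[ℂ] H} (h : ∀ x, 0 ≤ ⟪C x, x⟫_ℂ) : 0 ≤ C := by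
  rw [ContinuousLinearMap.nonneg_iff_isPositive, ContinuousLinearMap.isPositive_iff_complex]
  refine fun x => ⟨Complex.ext rfl ?_, (Complex.nonneg_iff.1 (h x)).1⟩
  exact (Complex.ofReal_im _).trans (Complex.nonneg_iff.1 (h x)).2

theorem inner_nonneg_of_nonneg {C : H →L[ℂ] H} (h : 0 ≤ C) (x : H) : 0 ≤ ⟪C x, x⟫_ℂ :=
  ((ContinuousLinearMap.nonneg_iff_isPositive C).1 h).inner_nonneg_left x

theorem nonneg_of_isInverse {T : H →ₗ.[ℂ] H} {C : H →L[ℂ] H}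
    (hT : IsPositive T) (h : IsInverse T C) : 0 ≤ C := by
  refine nonneg_of_inner_nonneg fun y => ?_
  obtain ⟨hy, hTy⟩ := h.2 y
  have h0 := hT ⟨C y, hy⟩
  rw [hTy, ← inner_conj_symm] at h0
  simpa using star_nonneg_iff.2 h0

/-! ### Quotients of bounded operators -/

/-- The operator `Z Q⁻¹` for bounded `Z`, `Q` with `Q` injective; its domain is the range of `Q`. -/
noncomputable def quotient (Z Q : H →L[ℂ] H) (hQ : Function.Injective Q) : H →ₗ.[ℂ] H where
  domain := (Q : H →ₗ[ℂ] H).range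
  toFun := (Z : H →ₗ[ℂ] H) ∘ₗ (LinearEquiv.ofInjective (Q : H →ₗ[ℂ] H) hQ).symm.toLinearMap

theorem quotient_apply {Z Q : H →L[ℂ] H} (hQ : Function.Injective Q) {u x : H} (h : Q u = x)
    (hx : x ∈ (quotient Z Q hQ).domain) : quotient Z Q hQ ⟨x, hx⟩ = Z u := by
  subst h
  exact congrArg Z ((LinearEquiv.ofInjective (Q : H →ₗ[ℂ] H) hQ).symm_apply_apply u)

theorem exists_quotient_apply (Z : H →L[ℂ] H) {Q : H →L[ℂ] H} (hQ : Function.Injective Q)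
    (x : (quotient Z Q hQ).domain) : ∃ u, Q u = x ∧ quotient Z Q hQ x = Z u := by
  obtain ⟨x, u, hu⟩ := x
  exact ⟨u, hu, quotient_apply hQ hu _⟩

variable [CompleteSpace H]

theorem dense_range_of_isSelfAdjoint {Q : H →L[ℂ] H} (h : IsSelfAdjoint Q)
    (hQ : Function.Injective Q) : Dense ((Q : H →ₗ[ℂ] H).range : Set H) := by
  rw [Submodule.dense_iff_topologicalClosure_eq_top, Submodule.topologicalClosure_eq_top_iff,
    ContinuousLinearMap.orthogonal_range, h.adjoint_eq]
  exact LinearMap.ker_eq_bot.2 hQ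

/-- If `y` is in the domain of the adjoint of `Z Q⁻¹`, with image `z`, then `Z y = Q z`, and so
`y = Z Z y + Q Q y = Q (Z z + Q y)` is in the range of `Q`. -/
theorem isSelfAdjoint_quotient {Z Q : H →L[ℂ] H} (hQ : Function.Injective Q)
    (hQs : IsSelfAdjoint Q) (hZs : IsSelfAdjoint Z) (hc : Z * Q = Q * Z)
    (h1 : Z * Z + Q * Q = 1) : IsSelfAdjoint (quotient Z Q hQ) := by
  have hd : Dense ((quotient Z Q hQ).domain : Set H) := dense_range_of_isSelfAdjoint hQs hQ
  have hsym : ∀ {S : H →L[ℂ] H}, IsSelfAdjoint S → ∀ x y, ⟪S x, y⟫_ℂ = ⟪x, S y⟫_ℂ :=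
    fun hS => hS.isSymmetric
  have hc' : ∀ u, Z (Q u) = Q (Z u) := DFunLike.congr_fun hc
  have hle : quotient Z Q hQ ≤ (quotient Z Q hQ).adjoint := by
    refine LinearPMap.IsFormalAdjoint.le_adjoint hd ?_
    intro x y
    obtain ⟨u, hu, hPu⟩ := exists_quotient_apply Z hQ x
    obtain ⟨v, hv, hPv⟩ := exists_quotient_apply Z hQ y
    rw [hPu, hPv, ← hu, ← hv, hsym hZs, hsym hQs, hc']
  refine (LinearPMap.eq_of_le_of_domain_eq hle (le_antisymm hle.1 fun y hy => ?_)).symm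
  set z := (quotient Z Q hQ).adjoint ⟨y, hy⟩ with hz
  have hzy : Z y = Q z := by
    refine ext_inner_right ℂ fun u => ?_
    have h := LinearPMap.adjoint_isFormalAdjoint hd ⟨y, hy⟩ ⟨Q u, u, rfl⟩
    have h' : ⟪z, Q u⟫_ℂ = ⟪y, Z u⟫_ℂ :=
      h.trans (congrArg (inner ℂ y) (quotient_apply hQ rfl _))
    rw [hsym hZs, hsym hQs, h']
  refine ⟨Z z + Q y, ?_⟩
  change Q (Z z + Q y) = y
  rw [map_add, ← hc', ← hzy]
  exact DFunLike.congr_fun h1 y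

/-- The commuting square roots `Q = √R` and `Z = √(1 - R)` of a bounded operator `0 ≤ R ≤ 1`,
taken in the continuous functional calculus of `R` so that their product is again nonnegative. -/
theorem exists_sqrt_pair {R : H →L[ℂ] H} (h0 : 0 ≤ R) (h1 : R ≤ 1) :
    ∃ Q Z : H →L[ℂ] H, IsSelfAdjoint Q ∧ IsSelfAdjoint Z ∧ Z * Q = Q * Z ∧ 0 ≤ Q * Z ∧
      Q * Q = R ∧ Z * Z + Q * Q = 1 := by
  have hR : IsSelfAdjoint R := IsSelfAdjoint.of_nonneg h0
  have hs0 : ∀ x ∈ spectrum ℝ R, 0 ≤ x := fun x hx => spectrum_nonneg_of_nonneg h0 hx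
  have hs1 : ∀ x ∈ spectrum ℝ R, x ≤ 1 := by
    have h := cfc_le_one_iff (fun x : ℝ => x) R
    rw [cfc_id' ℝ R] at h
    exact h.1 h1
  have hQQ : cfc Real.sqrt R * cfc Real.sqrt R = R := by
    rw [← cfc_mul Real.sqrt Real.sqrt R]
    conv_rhs => rw [← cfc_id' ℝ R]
    exact cfc_congr fun x hx => Real.mul_self_sqrt (hs0 x hx)
  have hZZ : cfc (fun x : ℝ => √(1 - x)) R * cfc (fun x : ℝ => √(1 - x)) R = 1 - R := by
    rw [← cfc_mul (fun x : ℝ => √(1 - x)) (fun x : ℝ => √(1 - x)) R]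
    have h : (1 : H →L[ℂ] H) - R = cfc (fun x : ℝ => 1 - x) R := by
      rw [cfc_sub (fun _ : ℝ => (1 : ℝ)) (fun x : ℝ => x) R, cfc_id' ℝ R, cfc_const_one ℝ R]
    rw [h]
    exact cfc_congr fun x hx => Real.mul_self_sqrt (sub_nonneg.2 (hs1 x hx))
  refine ⟨cfc Real.sqrt R, cfc (fun x : ℝ => √(1 - x)) R, cfc_predicate _ _,
    cfc_predicate _ _, (cfc_commute_cfc _ _ R).eq, ?_, hQQ, ?_⟩
  · rw [← cfc_mul Real.sqrt (fun x : ℝ => √(1 - x)) R]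
    exact cfc_nonneg fun x _ => mul_nonneg (Real.sqrt_nonneg _) (Real.sqrt_nonneg _)
  · rw [hQQ, hZZ, sub_add_cancel]

/-! ### The operator `A* A + B* B` -/

/-- The weak form of `(A* A + B* B) x = y + A* v`. The left-hand side is the form of a bounded
operator `F` on the graph of `A`, a Hilbert space because `A` is closed; the hypothesis makes `F`
coercive for the graph norm, hence invertible. -/
theorem exists_weak_solution {A : H →ₗ.[ℂ] H} (hA : A.IsClosed) (B : H →L[ℂ] H) (c : ℝ)
    (hc : ∀ x : A.domain, ‖(x : H)‖ ^ 2 ≤ c * (‖A x‖ ^ 2 + ‖B x‖ ^ 2)) (y v : H) :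
    ∃ x : A.domain, ∀ z : A.domain,
      ⟪A x - v, A z⟫_ℂ + ⟪B x, B z⟫_ℂ = ⟪y, (z : H)⟫_ℂ := by
  -- `WithLp 2` puts the Hilbert space structure on `H × H`; the plain product has the sup norm.
  let G : Submodule ℂ (WithLp 2 (H × H)) :=
    A.graph.comap (WithLp.linearEquiv 2 ℂ (H × H)).toLinearMap
  have hG : IsClosed (G : Set (WithLp 2 (H × H))) :=
    hA.preimage (WithLp.prod_continuous_ofLp 2 H H)
  have : CompleteSpace G := hG.completeSpace_coe
  let p : G →L[ℂ] H := WithLp.fstL 2 ℂ H H ∘L G.subtypeL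
  let q : G →L[ℂ] H := WithLp.sndL 2 ℂ H H ∘L G.subtypeL
  have hpq : ∀ g : G, ∃ x : A.domain, (x : H) = p g ∧ A x = q g := fun g =>
    (LinearPMap.mem_graph_iff _).1 g.2
  let F : G →L[ℂ] G := q.adjoint ∘L q + (B ∘L p).adjoint ∘L (B ∘L p)
  have hF : ∀ g h, ⟪F g, h⟫_ℂ = ⟪q g, q h⟫_ℂ + ⟪B (p g), B (p h)⟫_ℂ := fun g h => by
    simp only [F, add_apply, inner_add_left,
      ContinuousLinearMap.comp_apply, ContinuousLinearMap.adjoint_inner_left]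
  have hunit : IsUnit F := by
    have hk : (0 : ℝ) < |c| + 1 := by positivity
    refine ContinuousLinearMap.isUnit_of_forall_le_norm_inner_map F
      (c := ⟨(|c| + 1)⁻¹, by positivity⟩) (by exact_mod_cast inv_pos.2 hk) fun g => ?_
    obtain ⟨x, hx, hAx⟩ := hpq g
    have hn : ‖g‖ ^ 2 = ‖p g‖ ^ 2 + ‖q g‖ ^ 2 := WithLp.prod_norm_sq_eq_of_L2 (g : WithLp 2 (H × H))
    have h1 := hc x
    rw [hx, hAx] at h1
    have h2 : ⟪F g, g⟫_ℂ = ((‖q g‖ ^ 2 + ‖B (p g)‖ ^ 2 : ℝ) : ℂ) := by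
      rw [hF, inner_self_eq_norm_sq_to_K, inner_self_eq_norm_sq_to_K]; push_cast; rfl
    rw [h2, Complex.norm_real, Real.norm_of_nonneg (by positivity), hn]
    change _ * (|c| + 1)⁻¹ ≤ _
    rw [mul_inv_le_iff₀ hk]
    nlinarith [le_abs_self c, mul_le_mul_of_nonneg_right (le_abs_self c)
      (by positivity : 0 ≤ ‖q g‖ ^ 2 + ‖B (p g)‖ ^ 2), sq_nonneg ‖B (p g)‖]
  obtain ⟨E, hE⟩ := hunit.exists_right_inv
  let g : G := E (p.adjoint y + q.adjoint v)
  have hg : F g = p.adjoint y + q.adjoint v := DFunLike.congr_fun hE _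
  obtain ⟨x, hx, hAx⟩ := hpq g
  refine ⟨x, fun z => ?_⟩
  have h := hF g ⟨WithLp.toLp 2 ((z : H), A z), A.mem_graph z⟩
  rw [hg, inner_add_left, ContinuousLinearMap.adjoint_inner_left,
    ContinuousLinearMap.adjoint_inner_left] at h
  change ⟪y, (z : H)⟫_ℂ + ⟪v, A z⟫_ℂ = ⟪q g, A z⟫_ℂ + ⟪B (p g), B z⟫_ℂ at h
  rw [inner_sub_left, hx, hAx, sub_add_eq_add_sub, ← h, add_sub_cancel_right]

/-- The adjoint of a closed operator has dense domain. If `v` is orthogonal to it, solve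
`x + A* (A x - v) = 0` weakly: then `v - A x` lies in the domain of the adjoint, which forces
`‖v - A x‖² = -‖x‖²`. Density of the domain of `A` plays no role, because Mathlib defines the
domain of the adjoint by continuity of a functional. -/
theorem dense_adjoint_domain {A : H →ₗ.[ℂ] H} (hA : A.IsClosed) :
    Dense (A.adjoint.domain : Set H) := by
  rw [Submodule.dense_iff_topologicalClosure_eq_top, Submodule.topologicalClosure_eq_top_iff,
    Submodule.eq_bot_iff]
  intro v hv
  obtain ⟨x, hx⟩ := exists_weak_solution hA 1 1 (fun x => by simp) 0 v
  simp only [inner_zero_left, one_apply_eq_self] at hx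
  have hw : v - A x ∈ A.adjoint.domain := A.mem_adjoint_domain_of_exists _ ⟨x, fun z => by
    rw [← sub_eq_zero, ← hx z, ← neg_sub v, inner_neg_left]; ring⟩
  have h0 : ⟪v - A x, v⟫_ℂ = 0 := hv _ hw
  have h1 := hx x
  have h2 : ⟪v - A x, v - A x⟫_ℂ = -⟪(x : H), x⟫_ℂ := by
    rw [← neg_sub v, inner_neg_left] at h1
    rw [inner_sub_right, h0]
    linear_combination h1
  rw [inner_self_eq_norm_sq_to_K, inner_self_eq_norm_sq_to_K] at h2
  have h3 : ‖v - A x‖ ^ 2 = -‖(x : H)‖ ^ 2 := by exact_mod_cast h2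
  have h4 : ‖(x : H)‖ = 0 := by nlinarith [sq_nonneg ‖v - A x‖]
  have h5 : ‖v - A x‖ = 0 := by nlinarith [sq_nonneg ‖v - A x‖]
  have h6 : x = 0 := Subtype.ext (norm_eq_zero.1 h4)
  rw [h6, A.map_zero, sub_zero] at h5
  exact norm_eq_zero.1 h5

/-- The quadratic form of `A* A + B* B` is `‖A x‖² + ‖B x‖²`. -/
theorem inner_prod_adjoint_add {A : H →ₗ.[ℂ] H} (hd : Dense (A.domain : Set H))
    (B : H →L[ℂ] H) (x : (prod A.adjoint A + ofBdd (B.adjoint * B)).domain) :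
    ⟪(prod A.adjoint A + ofBdd (B.adjoint * B)) x, (x : H)⟫_ℂ =
      ((‖A ⟨x, x.2.1.1⟩‖ ^ 2 + ‖B x‖ ^ 2 : ℝ) : ℂ) := by
  have h1 : ⟪A.adjoint ⟨A ⟨x, x.2.1.1⟩, x.2.1.2⟩, (x : H)⟫_ℂ =
      ⟪A ⟨x, x.2.1.1⟩, A ⟨x, x.2.1.1⟩⟫_ℂ :=
    LinearPMap.adjoint_isFormalAdjoint hd ⟨A ⟨x, x.2.1.1⟩, x.2.1.2⟩ ⟨x, x.2.1.1⟩
  have h2 : ⟪(B.adjoint * B) x, (x : H)⟫_ℂ = ⟪B x, B x⟫_ℂ :=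
    ContinuousLinearMap.adjoint_inner_left B _ _
  rw [LinearPMap.add_apply, inner_add_left]
  refine (congrArg₂ (· + ·) h1 h2).trans ?_
  rw [inner_self_eq_norm_sq_to_K, inner_self_eq_norm_sq_to_K]; push_cast; rfl

theorem isInvertible_prod_adjoint_add {A : H →ₗ.[ℂ] H} (hA : A.IsClosed)
    (hd : Dense (A.domain : Set H)) (B : H →L[ℂ] H) (c : ℝ)
    (hc : ∀ x : A.domain, ‖(x : H)‖ ^ 2 ≤ c * (‖A x‖ ^ 2 + ‖B x‖ ^ 2)) :
    IsInvertible (prod A.adjoint A + ofBdd (B.adjoint * B)) := by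
  refine isInvertible_of_surjective |c| ?_ fun y => ?_
  -- Cauchy-Schwarz turns the lower bound on the form into a lower bound on `‖S x‖`.
  · set S := prod A.adjoint A + ofBdd (B.adjoint * B)
    intro x
    have h1 := hc ⟨x, x.2.1.1⟩
    have h2 := congrArg norm (inner_prod_adjoint_add hd B x)
    rw [Complex.norm_real, Real.norm_of_nonneg (by positivity)] at h2
    have h3 : ‖⟪S x, (x : H)⟫_ℂ‖ ≤ ‖S x‖ * ‖(x : H)‖ := norm_inner_le_norm _ _
    rw [h2] at h3
    rcases (norm_nonneg (x : H)).eq_or_lt with h | h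
    · rw [← h]; positivity
    · refine le_of_mul_le_mul_right ?_ h
      calc ‖(x : H)‖ * ‖(x : H)‖ = ‖(x : H)‖ ^ 2 := (sq _).symm
        _ ≤ c * (‖A ⟨x, x.2.1.1⟩‖ ^ 2 + ‖B x‖ ^ 2) := h1
        _ ≤ |c| * (‖A ⟨x, x.2.1.1⟩‖ ^ 2 + ‖B x‖ ^ 2) := by gcongr; exact le_abs_self c
        _ ≤ |c| * (‖S x‖ * ‖(x : H)‖) := by gcongr
        _ = |c| * ‖S x‖ * ‖(x : H)‖ := (mul_assoc _ _ _).symm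
  -- A weak solution is a strong one: the weak equation says that `A x` lies in the domain of `A*`.
  · obtain ⟨x, hx⟩ := exists_weak_solution hA B c hc y 0
    have hz : ∀ z : A.domain, ⟪y - B.adjoint (B x), (z : H)⟫_ℂ = ⟪A x, A z⟫_ℂ := fun z => by
      rw [inner_sub_left, ContinuousLinearMap.adjoint_inner_left, ← hx z, sub_zero,
        add_sub_cancel_right]
    have hmem : A x ∈ A.adjoint.domain := A.mem_adjoint_domain_of_exists _ ⟨_, hz⟩
    refine ⟨⟨x, ⟨x.2, hmem⟩, trivial⟩, ?_⟩
    have h := LinearPMap.adjoint_apply_eq hd ⟨A x, hmem⟩ hz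
    exact (congrArg (· + B.adjoint (B x)) h).trans (sub_add_cancel _ _)

/-! ### Existence of the absolute value -/

/-- A closed densely defined operator has an absolute value: with `R = (A* A + 1)⁻¹`, it is
`√(1 - R) (√R)⁻¹`, because `A* A = (1 - R) R⁻¹`. -/
theorem exists_isAbs {A : H →ₗ.[ℂ] H} (hA : A.IsClosed) (hd : Dense (A.domain : Set H)) :
    ∃ P, IsAbs A P := by
  obtain ⟨R, hR⟩ := isInvertible_prod_adjoint_add hA hd 1 1 (fun x => by simp)
  have hpos : IsPositive (prod A.adjoint A + ofBdd (ContinuousLinearMap.adjoint 1 * 1)) :=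
    fun x => by
      rw [inner_prod_adjoint_add hd 1 x]
      exact_mod_cast (by positivity : (0 : ℝ) ≤ _)
  have hone : ∀ x : H, ContinuousLinearMap.adjoint (1 : H →L[ℂ] H) x = x :=
    DFunLike.congr_fun ContinuousLinearMap.adjoint_id
  have hRadd : ∀ x : (prod A.adjoint A).domain, R (prod A.adjoint A x + x) = x := fun x => by
    have h := hR.1 ⟨x, x.2, trivial⟩
    rw [LinearPMap.add_apply] at h
    change R (prod A.adjoint A x + ContinuousLinearMap.adjoint 1 (x : H)) = x at h
    rwa [hone] at h
  have hRmem : ∀ y, ∃ h : R y ∈ (prod A.adjoint A).domain, prod A.adjoint A ⟨R y, h⟩ + R y = y :=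
    fun y => by
      obtain ⟨h, h'⟩ := hR.2 y
      refine ⟨h.1, ?_⟩
      rw [LinearPMap.add_apply] at h'
      change prod A.adjoint A ⟨R y, h.1⟩ + ContinuousLinearMap.adjoint 1 (R y) = y at h'
      rwa [hone] at h'
  have hR0 : 0 ≤ R := nonneg_of_isInverse hpos hR
  have hR1 : R ≤ 1 := by
    refine sub_nonneg.1 (nonneg_of_inner_nonneg fun y => ?_)
    obtain ⟨h, h'⟩ := hRmem y
    have h2 : ⟪prod A.adjoint A ⟨R y, h⟩, R y⟫_ℂ = ⟪A ⟨R y, h.1⟩, A ⟨R y, h.1⟩⟫_ℂ :=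
      LinearPMap.adjoint_isFormalAdjoint hd ⟨A ⟨R y, h.1⟩, h.2⟩ ⟨R y, h.1⟩
    have h3 : (1 - R) y = prod A.adjoint A ⟨R y, h⟩ := sub_eq_of_eq_add h'.symm
    rw [h3]
    nth_rw 2 [← h']
    rw [inner_add_right, h2]
    have hself : ∀ z : H, 0 ≤ ⟪z, z⟫_ℂ := fun z =>
      ContinuousLinearMap.isPositive_one.inner_nonneg_left z
    exact add_nonneg (hself _) (hself _)
  obtain ⟨Q, Z, hQs, hZs, hc, hQZ, hQQ, h1⟩ := exists_sqrt_pair hR0 hR1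
  have hc' : ∀ u, Z (Q u) = Q (Z u) := DFunLike.congr_fun hc
  have hQQ' : ∀ u, Q (Q u) = R u := DFunLike.congr_fun hQQ
  have h1' : ∀ u, Z (Z u) + Q (Q u) = u := DFunLike.congr_fun h1
  have hQ : Function.Injective Q := fun u v huv =>
    injective_of_isInverse hR (by rw [← hQQ', ← hQQ', huv])
  refine ⟨quotient Z Q hQ, isSelfAdjoint_quotient hQ hQs hZs hc h1, ?_, ?_⟩
  · intro x
    obtain ⟨u, hu, hPu⟩ := exists_quotient_apply Z hQ x
    have h : ⟪Z u, Q u⟫_ℂ = ⟪(Q * Z) u, u⟫_ℂ := (hQs.isSymmetric (Z u) u).symm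
    rw [hPu, ← hu, h]
    exact inner_nonneg_of_nonneg hQZ u
  · have hle : prod A.adjoint A ≤ prod (quotient Z Q hQ) (quotient Z Q hQ) := by
      -- `x = Q Q w` with `w = A* A x + x`, so `P = Z Q⁻¹` gives `P x = Q Z w` and `P P x = Z Z w`.
      have key : ∀ x : (prod A.adjoint A).domain,
          ∃ h : (x : H) ∈ (prod (quotient Z Q hQ) (quotient Z Q hQ)).domain,
            prod (quotient Z Q hQ) (quotient Z Q hQ) ⟨x, h⟩ = prod A.adjoint A x := fun x => by
        set w := prod A.adjoint A x + x with hw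
        have hx : Q (Q w) = x := (hQQ' w).trans (hRadd x)
        have hP : quotient Z Q hQ ⟨x, Q w, hx⟩ = Q (Z w) :=
          (quotient_apply hQ hx _).trans (hc' w)
        have hm : quotient Z Q hQ ⟨x, Q w, hx⟩ ∈ (quotient Z Q hQ).domain := ⟨Z w, hP.symm⟩
        refine ⟨⟨⟨Q w, hx⟩, hm⟩, (quotient_apply hQ hP.symm hm).trans ?_⟩
        rw [← add_left_inj (x : H), ← hw, ← hx, h1']
      refine ⟨fun x hx => (key ⟨x, hx⟩).1, fun x y hxy => ?_⟩
      obtain ⟨h, h'⟩ := key x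
      rw [← h']
      congr 1
      exact Subtype.ext hxy
    refine (LinearPMap.eq_of_le_of_domain_eq hle (le_antisymm hle.1 ?_)).symm
    -- If `x = Q u` and `P x = Z u = Q v`, then `u = Z Q v + Q Q u`, and so `x = R (Z v + Q u)`.
    rintro x ⟨hx, v, hv⟩
    obtain ⟨u, hu, hPu⟩ := exists_quotient_apply Z hQ ⟨x, hx⟩
    have hxR : x = R (Z v + Q u) := by
      rw [← hQQ', map_add, ← hc', show Q v = Z u from hv.trans hPu, h1']
      exact hu.symm
    rw [hxR]
    exact (hRmem _).1

theorem isAbs_abs {A : H →ₗ.[ℂ] H} (hA : A.IsClosed) (hd : Dense (A.domain : Set H)) :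
    IsAbs A (abs A) := by
  have h := exists_isAbs hA hd
  unfold abs
  rw [dif_pos h]
  exact h.choose_spec

/-! ### The inverse of `|A|² + |D|²` -/

/-- If the bounded operator `C ≥ 0` is a left inverse of `D* A`, then `|A|² + |D|²` is invertible,
and its inverse is at most `C`. -/
theorem isInvertible_and_inner_inv_le {A : H →ₗ.[ℂ] H} (hA : A.IsClosed)
    (hd : Dense (A.domain : Set H)) (D : H →L[ℂ] H) {C : H →L[ℂ] H} (hC : 0 ≤ C)
    (hCA : ∀ x : A.domain, C (D.adjoint (A x)) = x) :
    IsInvertible (prod (abs A) (abs A) + ofBdd (CFC.abs D ^ 2)) ∧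
      ∀ y : H, ⟪inv (prod (abs A) (abs A) + ofBdd (CFC.abs D ^ 2)) y, y⟫_ℂ ≤ ⟪C y, y⟫_ℂ := by
  rw [(isAbs_abs hA hd).2.2, CFC.abs_sq, ContinuousLinearMap.star_eq_adjoint]
  have hinv : IsInvertible (prod A.adjoint A + ofBdd (D.adjoint * D)) := by
    refine isInvertible_prod_adjoint_add hA hd D (‖C * D.adjoint‖ ^ 2) fun x => ?_
    -- Since `x = C D* A x`, already `A` is bounded below.
    have h : ‖(x : H)‖ ≤ ‖C * D.adjoint‖ * ‖A x‖ := by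
      conv_lhs => rw [← hCA x]
      exact (C * D.adjoint).le_opNorm (A x)
    calc ‖(x : H)‖ ^ 2 ≤ (‖C * D.adjoint‖ * ‖A x‖) ^ 2 := by gcongr
      _ = ‖C * D.adjoint‖ ^ 2 * ‖A x‖ ^ 2 := mul_pow _ _ _
      _ ≤ _ := by gcongr; exact le_add_of_nonneg_right (sq_nonneg _)
  refine ⟨hinv, fun y => ?_⟩
  have hE := inv_spec hinv
  obtain ⟨hx, hSx⟩ := hE.2 y
  set x := inv (prod A.adjoint A + ofBdd (D.adjoint * D)) y
  set a := A ⟨x, hx.1.1⟩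
  set r : ℝ := ‖a‖ ^ 2 + ‖D x‖ ^ 2 with hr
  have hyx : ⟪y, x⟫_ℂ = (r : ℂ) := by
    have h := inner_prod_adjoint_add hd D ⟨x, hx⟩
    rwa [hSx] at h
  have hxy : ⟪x, y⟫_ℂ = (r : ℂ) := by rw [← inner_conj_symm, hyx, Complex.conj_ofReal]
  have hCw : C (D.adjoint a) = x := hCA ⟨x, hx.1.1⟩
  have hCs : IsSelfAdjoint C := IsSelfAdjoint.of_nonneg hC
  have hCyw : ⟪C y, D.adjoint a⟫_ℂ = (r : ℂ) := by
    rw [← hyx, ← hCw]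
    exact hCs.isSymmetric _ _
  have hxw : ⟪x, D.adjoint a⟫_ℂ = ⟪D x, a⟫_ℂ := ContinuousLinearMap.adjoint_inner_right _ _ _
  -- With `w = D* A x`, expanding `0 ≤ ⟪C (w - y), w - y⟫` gives `2 r ≤ Re ⟪D x, A x⟫ + ⟪C y, y⟫`,
  -- and `Re ⟪D x, A x⟫ ≤ r / 2` by the inequality between the two means.
  have hpos := (Complex.nonneg_iff.1 (inner_nonneg_of_nonneg hC (D.adjoint a - y))).1
  rw [map_sub, hCw, inner_sub_left, inner_sub_right, inner_sub_right, hxy, hCyw, hxw] at hpos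
  simp only [Complex.sub_re, Complex.ofReal_re] at hpos
  have hre : (⟪D x, a⟫_ℂ).re ≤ ‖D x‖ * ‖a‖ :=
    (Complex.re_le_norm _).trans (norm_inner_le_norm _ _)
  rw [hxy, Complex.le_def]
  refine ⟨?_, (Complex.nonneg_iff.1 (inner_nonneg_of_nonneg hC y)).2⟩
  rw [Complex.ofReal_re]
  nlinarith [sq_nonneg (‖D x‖ - ‖a‖), sq_nonneg ‖D x‖, sq_nonneg ‖a‖]

end

end UnbOp

theorem mainTheorem3 {H : Type*} [NormedAddCommGroup H] [InnerProductSpace ℂ H] [CompleteSpace H]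
    (A : H →ₗ.[ℂ] H) (hA : A.IsClosed) (B : H →L[ℂ] H) :
    (UnbOp.IsPositive (UnbOp.prod (UnbOp.ofBdd B) A) →
      UnbOp.IsInvertible (UnbOp.prod (UnbOp.ofBdd B) A) →
        Dense (A.domain : Set H) ∧
        UnbOp.IsInvertible (UnbOp.prod (UnbOp.abs A) (UnbOp.abs A)
          + UnbOp.ofBdd (CFC.abs (ContinuousLinearMap.adjoint B) ^ 2)) ∧
        ∀ x : H,
          ⟪UnbOp.inv (UnbOp.prod (UnbOp.abs A) (UnbOp.abs A)
            + UnbOp.ofBdd (CFC.abs (ContinuousLinearMap.adjoint B) ^ 2)) x, x⟫_ℂ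
          ≤ ⟪UnbOp.inv (UnbOp.prod (UnbOp.ofBdd B) A) x, x⟫_ℂ) ∧
    (Dense (A.domain : Set H) →
      Dense ((UnbOp.prod A (UnbOp.ofBdd B)).domain : Set H) →
      UnbOp.IsPositive (UnbOp.prod A (UnbOp.ofBdd B)) →
      UnbOp.IsInvertible (UnbOp.prod A (UnbOp.ofBdd B)) →
        UnbOp.IsInvertible (UnbOp.prod (UnbOp.abs A.adjoint) (UnbOp.abs A.adjoint)
          + UnbOp.ofBdd (CFC.abs B ^ 2)) ∧
        ∀ x : H,
          ⟪UnbOp.inv (UnbOp.prod (UnbOp.abs A.adjoint) (UnbOp.abs A.adjoint)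
            + UnbOp.ofBdd (CFC.abs B ^ 2)) x, x⟫_ℂ
          ≤ ⟪UnbOp.inv (UnbOp.prod A (UnbOp.ofBdd B)) x, x⟫_ℂ) := by
  constructor
  · intro hpos hinv
    have hC := UnbOp.inv_spec hinv
    have hC0 := UnbOp.nonneg_of_isInverse hpos hC
    -- The domain of `A` contains the range of the injective self-adjoint operator `(B A)⁻¹`.
    have hd : Dense (A.domain : Set H) :=
      (UnbOp.dense_range_of_isSelfAdjoint (IsSelfAdjoint.of_nonneg hC0)
        (UnbOp.injective_of_isInverse hC)).mono (by
          rintro _ ⟨y, rfl⟩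
          exact (hC.2 y).1.1)
    refine ⟨hd, UnbOp.isInvertible_and_inner_inv_le hA hd _ hC0 fun x => ?_⟩
    rw [ContinuousLinearMap.adjoint_adjoint]
    exact hC.1 ⟨x, x.2, trivial⟩
  · intro hd _ hpos hinv
    have hC := UnbOp.inv_spec hinv
    have hC0 := UnbOp.nonneg_of_isInverse hpos hC
    refine UnbOp.isInvertible_and_inner_inv_le (LinearPMap.adjoint_isClosed hd)
      (UnbOp.dense_adjoint_domain hA) _ hC0 fun x => ext_inner_right ℂ fun y => ?_
    -- `⟪C B* A* x, y⟫ = ⟪x, A B C y⟫ = ⟪x, y⟫`: so `C = (A B)⁻¹` is a left inverse of `B* A*`.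
    obtain ⟨h, hy⟩ := hC.2 y
    refine ((IsSelfAdjoint.of_nonneg hC0).isSymmetric _ _).trans ?_
    refine (ContinuousLinearMap.adjoint_inner_left B _ _).trans ?_
    refine (LinearPMap.adjoint_isFormalAdjoint hd x ⟨_, h.2⟩).trans ?_
    exact congrArg (inner ℂ (x : H)) hy
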